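/- Let $s_A, s_B, s_C \in (0,1)$ be real numbers with $s_C > s_A - s_B \ge 0$. Then there exist Borel sets $A, B, C \subset \mathbb{R}$ with Hausdorff dimensions $\dim_{\mathcal H} A = s_A$, $\dim_{\mathcal H} B = s_B$, $\dim_{\mathcal H} C = s_C$ such that, for every $c \in C$, $$\dim_{\mathcal H}(A + cB) \le \min\left\{\frac{s_A+s_B+s_C}{2},\ s_A+s_B,\ 1\right\},$$ where $A + cB = \{a + cb : a \in A,\ b \in B\}$. -/

import Mathlib

open scoped Pointwise

open Set Filter MeasureTheory Metric
open scoped ENNReal NNReal Topology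

/-! At scale `2 ^ (-k)` the sets are modelled on arithmetic grids. Put `M ≈ 2 ^ (k (sA - sB))`, `N ≈
2 ^ (k sB)` and `Q ≈ 2 ^ (k (sC - (sA - sB)) / 2)`. Near every chosen scale, `A` lies close to
multiples of `1 / (M N)`, `B` close to multiples of `1 / N`, and `C` close to fractions `p / (q M)`
with `q ≤ Q`. Up to constants, these grids have `2 ^ (k sA)`, `2 ^ (k sB)` and `M Q ^ 2 ≈ 2 ^ (k
sC)` points per unit length. If `c ≈ p / (q M)`, then `a + c b` is close to a multiple of `1 / (q M
N)`, so about `M N Q ≈ 2 ^ (k (sA + sB + sC) / 2)` intervals cover `A + c B`; counting pairs gives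
`sA + sB` instead, and the bound `1` is trivial.

Upper bounds need covers only along a sequence of scales (`dimH_le_of_frequently_cover`). For lower
bounds, the scales grow so fast that each set contains the limit set of a tree of nested intervals,
whose uniform measure obeys a Frostman condition for every exponent below the target
(`IsBranching.le_dimH`). This requires the grids to be separated and evenly distributed
(`IsSpread`); for `C` that is the count of rationals of bounded denominator in
`exists_finset_rat_den_le`, obtained from Dirichlet's theorem. -/

/-! ### Bounding Hausdorff dimension by covers and by measures -/

/-- A set covered, at arbitrarily small dyadic scales `2⁻ᵏ`, by `O(2 ^ (k t))` intervals of length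
`O(2⁻ᵏ)` has Hausdorff dimension at most `t`. -/
theorem dimH_le_of_frequently_cover {S : Set ℝ} {t D : ℝ} (ht : 0 ≤ t) (hD : 0 ≤ D)
    (h : ∀ N : ℕ, ∃ k ≥ N, ∃ F : Finset ℝ, (F.card : ℝ) ≤ D * 2 ^ (k * t) ∧
      S ⊆ ⋃ y ∈ F, closedBall y (D * 2 ^ (-(k : ℝ)))) :
    dimH S ≤ ENNReal.ofReal t := by
  choose κ hκ F hF hS using h
  have hκ' : Tendsto κ atTop atTop := tendsto_atTop_mono hκ tendsto_id
  have hlim : Tendsto (fun N ↦ ENNReal.ofReal (2 * D * 2 ^ (-(κ N : ℝ)))) atTop (𝓝 0) := by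
    have h1 : Tendsto (fun x : ℝ ↦ (2 : ℝ) ^ (-x)) atTop (𝓝 0) := by
      have := tendsto_rpow_atTop_of_base_lt_one (1 / 2 : ℝ) (by norm_num) (by norm_num)
      refine this.congr fun x ↦ ?_
      rw [one_div, Real.inv_rpow (by norm_num), Real.rpow_neg (by norm_num)]
    have h2 := ((h1.comp tendsto_natCast_atTop_atTop).comp hκ').const_mul (2 * D)
    have h3 := ENNReal.tendsto_ofReal h2
    simpa using h3
  have hdiam (N : ℕ) (i : F N) : ediam (closedBall (i : ℝ) (D * 2 ^ (-(κ N : ℝ)))) =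
      ENNReal.ofReal (2 * D * 2 ^ (-(κ N : ℝ))) := by
    rw [Real.closedBall_eq_Icc, Real.ediam_Icc]
    congr 1
    ring
  have hμ : μH[t] S ≤ ENNReal.ofReal (D * (2 * D) ^ t) := by
    refine (Measure.hausdorffMeasure_le_liminf_sum (ι := fun N ↦ F N) t S _ hlim
      (fun N i ↦ closedBall (i : ℝ) (D * 2 ^ (-(κ N : ℝ))))
      (Eventually.of_forall fun N i ↦ (hdiam N i).le)
      (Eventually.of_forall fun N ↦ ?_)).trans ?_
    · simpa [iUnion_subtype] using hS N
    · refine (liminf_le_liminf (v := fun _ ↦ ENNReal.ofReal (D * (2 * D) ^ t))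
        (Eventually.of_forall fun N ↦ ?_)).trans_eq (liminf_const _)
      simp only [hdiam]
      rw [Finset.sum_const, Finset.card_univ, Fintype.card_coe, nsmul_eq_mul,
        ENNReal.ofReal_rpow_of_nonneg (by positivity) ht, ← ENNReal.ofReal_natCast,
        ← ENNReal.ofReal_mul (by positivity)]
      refine ENNReal.ofReal_le_ofReal ?_
      calc ((F N).card : ℝ) * (2 * D * 2 ^ (-(κ N : ℝ))) ^ t
          ≤ D * 2 ^ (κ N * t) * (2 * D * 2 ^ (-(κ N : ℝ))) ^ t := by gcongr; exact hF N
        _ = D * (2 * D) ^ t := by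
            rw [Real.mul_rpow (by positivity) (by positivity), ← Real.rpow_mul (by norm_num),
              neg_mul, Real.rpow_neg (by norm_num)]
            field_simp
  have := dimH_le_of_hausdorffMeasure_ne_top (s := S) (d := t.toNNReal)
    (by rw [Real.coe_toNNReal _ ht]; exact (hμ.trans_lt ENNReal.ofReal_lt_top).ne)
  exact this

/-- Mass distribution principle on the line. -/
theorem le_dimH_of_measure_Icc_le {A : Set ℝ} (ν : Measure ℝ) (hA : ν A ≠ 0) {t D ρ : ℝ}
    (ht : 0 ≤ t) (hD : 0 < D) (hρ : 0 < ρ)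
    (h : ∀ y r, 0 < r → r < ρ → ν (Icc y (y + r)) ≤ ENNReal.ofReal (D * r ^ t)) :
    ENNReal.ofReal t ≤ dimH A := by
  have key : (ENNReal.ofReal D)⁻¹ • ν ≤ μH[t] := by
    refine Measure.le_hausdorffMeasure t _ (ENNReal.ofReal (ρ / 2)) (by simpa using hρ) ?_
    intro U hU
    rcases U.eq_empty_or_nonempty with rfl | hne
    · simp
    have hfin : ediam U ≠ ∞ := (hU.trans_lt ENNReal.ofReal_lt_top).ne
    have hb : Bornology.IsBounded U := isBounded_iff_ediam_ne_top.2 hfin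
    have hsub : U ⊆ Icc (sInf U) (sSup U) := subset_Icc_csInf_csSup hb.bddBelow hb.bddAbove
    have hd : diam U = sSup U - sInf U := Real.diam_eq hb
    have hdρ : diam U < ρ := by
      have : diam U ≤ ρ / 2 := ENNReal.toReal_le_of_le_ofReal (by positivity) hU
      linarith
    -- The hypothesis needs `0 < r`, whereas `diam U` may vanish; letting `r` decrease to `diam U`
    -- covers both cases.
    have hbound : ν U ≤ ENNReal.ofReal (D * diam U ^ t) := by
      have hc : Tendsto (fun r : ℝ ↦ ENNReal.ofReal (D * r ^ t)) (𝓝[>] diam U)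
          (𝓝 (ENNReal.ofReal (D * diam U ^ t))) := by
        refine ENNReal.tendsto_ofReal (Tendsto.const_mul D ?_)
        exact ((Real.continuous_rpow_const ht).tendsto _).mono_left nhdsWithin_le_nhds
      refine ge_of_tendsto hc ?_
      filter_upwards [Ioo_mem_nhdsGT hdρ] with r hr
      refine (measure_mono ?_).trans (h (sInf U) r (diam_nonneg.trans_lt hr.1) hr.2)
      exact hsub.trans (Icc_subset_Icc_right (by linarith [hr.1]))
    rw [Measure.smul_apply, smul_eq_mul]
    have hD' : ENNReal.ofReal D ≠ 0 := by simpa using hD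
    have hediam : ediam U ^ t = ENNReal.ofReal (diam U ^ t) := by
      rw [← ENNReal.ofReal_rpow_of_nonneg diam_nonneg ht, diam, ENNReal.ofReal_toReal hfin]
    rw [hediam, ENNReal.inv_mul_le_iff hD' ENNReal.ofReal_ne_top, ← ENNReal.ofReal_mul hD.le]
    exact hbound
  have hne : μH[t] A ≠ 0 := by
    intro h0
    have := key A
    rw [h0, Measure.smul_apply, smul_eq_mul, nonpos_iff_eq_zero, mul_eq_zero] at this
    simp [hA] at this
  exact le_dimH_of_hausdorffMeasure_ne_zero (s := A) (d := t.toNNReal)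
    (by rwa [Real.coe_toNNReal _ ht])

/-- A finite set of reals with gaps at least `d` in an interval of length `R` has at most
`1 + R / d` elements. -/
theorem card_le_of_separated {F : Finset ℝ} {a R d : ℝ} (hd : 0 < d) (hR : 0 ≤ R)
    (hF : ∀ x ∈ F, x ∈ Icc a (a + R)) (hsep : ∀ x ∈ F, ∀ y ∈ F, x ≠ y → d ≤ |x - y|) :
    (F.card : ℝ) ≤ 1 + R / d := by
  have hcard : F.card ≤ (Finset.range (⌊R / d⌋₊ + 1)).card := by
    refine Finset.card_le_card_of_injOn (fun x ↦ ⌊(x - a) / d⌋₊) ?_ ?_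
    · intro x hx
      have := hF x hx
      simp only [Finset.coe_range, mem_Iio, Order.lt_add_one_iff]
      refine Nat.floor_le_floor ?_
      gcongr
      linarith [this.2]
    · intro x hx y hy hxy
      by_contra hne
      have h1 := hsep x hx y hy hne
      have hx0 : 0 ≤ (x - a) / d := div_nonneg (by linarith [(hF x hx).1]) hd.le
      have hy0 : 0 ≤ (y - a) / d := div_nonneg (by linarith [(hF y hy).1]) hd.le
      have hx1 := Nat.floor_le hx0
      have hx2 := Nat.lt_floor_add_one ((x - a) / d)
      have hy1 := Nat.floor_le hy0
      have hy2 := Nat.lt_floor_add_one ((y - a) / d)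
      simp only at hxy
      rw [hxy] at hx1 hx2
      have : |(x - a) / d - (y - a) / d| < 1 := by rw [abs_lt]; constructor <;> linarith
      rw [← sub_div, abs_div, abs_of_pos hd, div_lt_one hd] at this
      ring_nf at this h1
      linarith
  have h2 : (F.card : ℝ) ≤ ⌊R / d⌋₊ + 1 := by
    rw [Finset.card_range] at hcard
    exact_mod_cast hcard
  linarith [Nat.floor_le (div_nonneg hR hd.le)]

/-! ### Trees of nested intervals and their uniform measure -/

/-- The left endpoints along the branch `ω` of a tree of nested intervals, where `e n y j` is the
`j`-th child of an interval of generation `n` with left endpoint `y`. -/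
noncomputable def branchPoint {m : ℕ → ℕ} (e : ∀ n, ℝ → Fin (m n) → ℝ) (ω : ∀ n, Fin (m n)) :
    ℕ → ℝ
  | 0 => 0
  | n + 1 => e n (branchPoint e ω n) (ω n)

/-- The point of the limit set of the tree that the branch `ω` converges to. -/
noncomputable def branchLimit {m : ℕ → ℕ} (e : ∀ n, ℝ → Fin (m n) → ℝ) (ω : ∀ n, Fin (m n)) : ℝ :=
  ⨆ n, branchPoint e ω n

/-- The uniform probability measure on the branches of a tree. -/
noncomputable def branchMeasure (m : ℕ → ℕ) [∀ n, NeZero (m n)] : Measure (∀ n, Fin (m n)) :=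
  Measure.infinitePi fun n ↦ (PMF.uniformOfFintype (Fin (m n))).toMeasure

instance (m : ℕ → ℕ) [∀ n, NeZero (m n)] : IsProbabilityMeasure (branchMeasure m) := by
  unfold branchMeasure; infer_instance

/-- A tree of nested intervals whose intervals of generation `n` have length `δ n` and left
endpoints at mutual distances at least `d n`. -/
structure IsBranching {m : ℕ → ℕ} (e : ∀ n, ℝ → Fin (m n) → ℝ) (δ d : ℕ → ℝ) : Prop where
  length_pos : ∀ n, 0 < δ n
  length_succ_le : ∀ n, δ (n + 1) ≤ δ n / 2
  mem_Icc : ∀ n y j, e n y j ∈ Icc y (y + δ n / 2)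
  separated : ∀ n y y' j j', e n y j ≠ e n y' j' → d (n + 1) ≤ |e n y j - e n y' j'|
  injective : ∀ n y, Function.Injective (e n y)
  length_lt_gap : ∀ n, δ (n + 1) < d (n + 1)

section Branching

variable {m : ℕ → ℕ} {e : ∀ n, ℝ → Fin (m n) → ℝ} {δ d : ℕ → ℝ}

/-- A generation has finitely many points, each determined by finitely many coordinates, so no
measurability of `e` or `S` is needed. -/
theorem measurableSet_branchPoint_mem (e : ∀ n, ℝ → Fin (m n) → ℝ) (n : ℕ) :
    ∀ S : Set ℝ, MeasurableSet {ω | branchPoint e ω n ∈ S} := by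
  induction n with
  | zero => intro S; simp [branchPoint]
  | succ n ih =>
    intro S
    have : {ω | branchPoint e ω (n + 1) ∈ S} =
        ⋃ j : Fin (m n), {ω | ω n = j} ∩ {ω | branchPoint e ω n ∈ {y | e n y j ∈ S}} := by
      ext ω
      simp [branchPoint]
    rw [this]
    refine MeasurableSet.iUnion fun j ↦ MeasurableSet.inter ?_ (ih _)
    exact measurableSet_eq_fun (measurable_pi_apply n) measurable_const

theorem measurable_branchLimit (e : ∀ n, ℝ → Fin (m n) → ℝ) : Measurable (branchLimit e) :=
  Measurable.iSup fun n S _ ↦ measurableSet_branchPoint_mem e n S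

theorem branchMeasure_cylinder [∀ n, NeZero (m n)] (n : ℕ) (v : ∀ n, Fin (m n)) :
    branchMeasure m {ω | ∀ i < n, ω i = v i} =
      ENNReal.ofReal (∏ i ∈ Finset.range n, (m i : ℝ)⁻¹) := by
  have h : {ω : ∀ n, Fin (m n) | ∀ i < n, ω i = v i} =
      Set.pi (Finset.range n : Set ℕ) fun i ↦ {v i} := by
    ext ω; simp [Set.mem_pi]
  rw [h, branchMeasure, Measure.infinitePi_pi _ (fun i _ ↦ measurableSet_singleton _),
    ENNReal.ofReal_prod_of_nonneg (fun i _ ↦ by positivity)]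
  refine Finset.prod_congr rfl fun i _ ↦ ?_
  rw [PMF.toMeasure_apply_singleton _ _ (measurableSet_singleton _),
    PMF.uniformOfFintype_apply, Fintype.card_fin,
    ENNReal.ofReal_inv_of_pos (by exact_mod_cast Nat.pos_of_ne_zero (NeZero.ne _)),
    ENNReal.ofReal_natCast]

namespace IsBranching

theorem branchPoint_mono (h : IsBranching e δ d) (ω : ∀ n, Fin (m n)) :
    Monotone (branchPoint e ω) :=
  monotone_nat_of_le_succ fun n ↦ (h.mem_Icc n _ _).1

theorem antitone_branchPoint_add (h : IsBranching e δ d) (ω : ∀ n, Fin (m n)) :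
    Antitone fun n ↦ branchPoint e ω n + δ n := by
  refine antitone_nat_of_succ_le fun n ↦ ?_
  have h1 := (h.mem_Icc n (branchPoint e ω n) (ω n)).2
  have h2 := h.length_succ_le n
  simp only [branchPoint]
  linarith

theorem branchPoint_mem_Icc (h : IsBranching e δ d) (ω : ∀ n, Fin (m n)) {n N : ℕ} (hn : n ≤ N) :
    branchPoint e ω N ∈ Icc (branchPoint e ω n) (branchPoint e ω n + δ n) := by
  have h1 := h.antitone_branchPoint_add ω hn
  exact ⟨h.branchPoint_mono ω hn, by simp only at h1; linarith [h.length_pos N]⟩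

theorem branchLimit_mem_Icc (h : IsBranching e δ d) (ω : ∀ n, Fin (m n)) (n : ℕ) :
    branchLimit e ω ∈ Icc (branchPoint e ω n) (branchPoint e ω n + δ n) := by
  have hb : ∀ N, branchPoint e ω N ≤ branchPoint e ω n + δ n := by
    intro N
    rcases le_total n N with hN | hN
    · exact (h.branchPoint_mem_Icc ω hN).2
    · exact (h.branchPoint_mono ω hN).trans (by linarith [h.length_pos n])
  exact ⟨le_ciSup ⟨_, forall_mem_range.2 hb⟩ n, ciSup_le hb⟩

/-- Intervals of one generation are shorter than the gaps between their left endpoints, so a point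
of the next generation lies in only one of them: it determines its parent, and inductively all its
ancestors. -/
theorem eq_of_branchPoint_eq (h : IsBranching e δ d) {ω ω' : ∀ n, Fin (m n)} (n : ℕ)
    (hn : branchPoint e ω n = branchPoint e ω' n) : ∀ i < n, ω i = ω' i := by
  induction n with
  | zero => intro i hi; omega
  | succ n ih =>
    have hp : branchPoint e ω n = branchPoint e ω' n := by
      rcases n with _ | n
      · rfl
      by_contra hne
      have h1 := h.separated n _ _ _ _ hne
      have h2 := h.length_lt_gap n
      have h3 := h.branchPoint_mem_Icc ω (Nat.le_succ (n + 1))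
      have h4 := h.branchPoint_mem_Icc ω' (Nat.le_succ (n + 1))
      simp only [Nat.succ_eq_add_one] at h3 h4
      rw [hn] at h3
      have : |branchPoint e ω (n + 1) - branchPoint e ω' (n + 1)| ≤ δ (n + 1) := by
        rw [abs_le]; constructor <;> linarith [h3.1, h3.2, h4.1, h4.2]
      exact absurd (h1.trans this) (not_le.2 h2)
    intro i hi
    rcases Nat.lt_succ_iff_lt_or_eq.1 hi with hi | rfl
    · exact ih hp i hi
    · simp only [branchPoint, hp] at hn
      exact h.injective _ _ hn

/-- The mass that the limit measure of the tree gives to an interval. -/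
theorem branchMeasure_Icc_le [∀ n, NeZero (m n)] (h : IsBranching e δ d) {n : ℕ}
    (hgap : 2 * δ (n + 1) ≤ d (n + 1)) {y r : ℝ} (hr : δ (n + 2) ≤ r) (hr' : r < δ (n + 1)) :
    branchMeasure m {ω | branchLimit e ω ∈ Icc y (y + r)} ≤
      ENNReal.ofReal ((1 + 2 * r / d (n + 2)) * ∏ i ∈ Finset.range (n + 2), (m i : ℝ)⁻¹) := by
  classical
  set W : Set (∀ n, Fin (m n)) := {ω | branchLimit e ω ∈ Icc y (y + r)} with hW
  have hr0 : 0 < r := (h.length_pos _).trans_le hr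
  have hd0 : 0 < d (n + 2) := (h.length_pos _).trans (h.length_lt_gap _)
  rcases W.eq_empty_or_nonempty with hWe | ⟨v, hv⟩
  · simp [hWe]
  -- Two limits within `r < δ (n + 1)` of each other have ancestors less than `2 * δ (n + 1)` apart,
  -- hence equal by the gap hypothesis.
  have hpt : ∀ ω ∈ W, branchPoint e ω (n + 1) = branchPoint e v (n + 1) := by
    intro ω hω
    by_contra hne
    have h1 := h.separated n _ _ _ _ hne
    have h2 := h.branchLimit_mem_Icc ω (n + 1)
    have h3 := h.branchLimit_mem_Icc v (n + 1)
    have : |branchPoint e ω (n + 1) - branchPoint e v (n + 1)| < 2 * δ (n + 1) := by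
      rw [abs_lt]
      constructor <;> linarith [h2.1, h2.2, h3.1, h3.2, hω.1, hω.2, hv.1, hv.2]
    exact absurd (hgap.trans h1) (not_le.2 this)
  set J : Finset (Fin (m (n + 1))) := Finset.univ.filter fun j ↦ ∃ ω ∈ W, ω (n + 1) = j with hJ
  have hcard : (J.card : ℝ) ≤ 1 + 2 * r / d (n + 2) := by
    rw [← Finset.card_image_of_injective J (h.injective (n + 1) (branchPoint e v (n + 1)))]
    -- Since `δ (n + 2) ≤ r`, the left endpoints of the intervals counted lie in `[y - r, y + r]`.
    refine card_le_of_separated (a := y - r) hd0 (by positivity) ?_ ?_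
    · intro x hx
      obtain ⟨j, hj, rfl⟩ := Finset.mem_image.1 hx
      obtain ⟨ω, hω, rfl⟩ := (Finset.mem_filter.1 hj).2
      have h2 := h.branchLimit_mem_Icc ω (n + 2)
      simp only [branchPoint] at h2
      have h3 := hpt ω hω
      simp only [branchPoint] at h3
      rw [h3] at h2
      simp only [branchPoint]
      constructor <;> linarith [h2.1, h2.2, hω.1, hω.2]
    · intro x hx x' hx' hne
      obtain ⟨j, -, rfl⟩ := Finset.mem_image.1 hx
      obtain ⟨j', -, rfl⟩ := Finset.mem_image.1 hx'
      exact h.separated (n + 1) _ _ _ _ hne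
  have hcover : W ⊆ ⋃ j ∈ J, {ω | ∀ i < n + 2, ω i = Function.update v (n + 1) j i} := by
    intro ω hω
    refine mem_iUnion₂.2 ⟨ω (n + 1), Finset.mem_filter.2 ⟨Finset.mem_univ _, ω, hω, rfl⟩, ?_⟩
    intro i hi
    rcases eq_or_ne i (n + 1) with rfl | hne
    · simp
    · rw [Function.update_of_ne hne]
      exact h.eq_of_branchPoint_eq (n + 1) (hpt ω hω) i (by omega)
  calc branchMeasure m W
      ≤ ∑ j ∈ J, branchMeasure m {ω | ∀ i < n + 2, ω i = Function.update v (n + 1) j i} :=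
        (measure_mono hcover).trans (measure_biUnion_finset_le _ _)
    _ = ENNReal.ofReal (J.card * ∏ i ∈ Finset.range (n + 2), (m i : ℝ)⁻¹) := by
        simp only [branchMeasure_cylinder, Finset.sum_const, nsmul_eq_mul]
        rw [ENNReal.ofReal_mul (by positivity), ENNReal.ofReal_natCast]
    _ ≤ _ := by
        refine ENNReal.ofReal_le_ofReal (mul_le_mul_of_nonneg_right hcard ?_)
        exact Finset.prod_nonneg fun i _ ↦ by positivity

end IsBranching

end Branching

/-! ### Spread families and the lower bound for their limit sets -/

/-- The sets `E k` have gaps at least `2 ^ (-k s)`, and eventually contain at least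
`c ℓ 2 ^ (k s)` points of each interval of length `ℓ`. -/
structure IsSpread (E : ℕ → Set ℝ) (s c : ℝ) : Prop where
  separated : ∀ k, ∀ x ∈ E k, ∀ y ∈ E k, x ≠ y → (2 : ℝ) ^ (-(k * s)) ≤ |x - y|
  exists_finset : ∀ ℓ > 0, ∃ K : ℕ, ∀ k ≥ K, ∀ x : ℝ, ∃ F : Finset ℝ,
    (∀ z ∈ F, z ∈ E k ∧ z ∈ Icc x (x + ℓ)) ∧ c * ℓ * 2 ^ (k * s) ≤ F.card

/-- The points of the unit interval that are `2 ^ (-k n)`-close to `E (k n)` for all `n ≥ 1`. -/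
def limitSet (E : ℕ → Set ℝ) (k : ℕ → ℕ) : Set ℝ :=
  Icc 0 1 ∩ ⋂ n, ⋃ y ∈ E (k (n + 1)), closedBall y (2 ^ (-(k (n + 1) : ℝ)))

theorem measurableSet_limitSet {E : ℕ → Set ℝ} (hE : ∀ k, (E k).Countable) (k : ℕ → ℕ) :
    MeasurableSet (limitSet E k) :=
  measurableSet_Icc.inter <| MeasurableSet.iInter fun _ ↦
    MeasurableSet.biUnion (hE _) fun _ _ ↦ measurableSet_closedBall

/-- A lower bound for the dimension of the limit set of a tree of nested intervals. -/
theorem IsBranching.le_dimH {m : ℕ → ℕ} [∀ n, NeZero (m n)] {e : ∀ n, ℝ → Fin (m n) → ℝ}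
    {k : ℕ → ℕ} {s c : ℝ} (hs : s < 1) (hc : 0 < c) {D : ℕ} (hD : 2 / c ≤ 2 ^ D)
    (h : IsBranching e (fun n ↦ 2 ^ (-(k n : ℝ))) fun n ↦ 2 ^ (-(k n * s)))
    (hm : ∀ n, c * (2 ^ (-(k n : ℝ)) / 2) * 2 ^ (k (n + 1) * s) ≤ m n)
    (hk : ∀ n, (n + 1) * (k n + D) ≤ k (n + 1)) (hk' : StrictMono k)
    {S : Set ℝ} (hS : MeasurableSet S) (hmem : ∀ ω, branchLimit e ω ∈ S) :
    ENNReal.ofReal s ≤ dimH S := by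
  refine le_of_forall_lt fun u hu ↦ ?_
  obtain ⟨t, hut, hts⟩ := ENNReal.lt_iff_exists_nnreal_btwn.1 hu
  refine hut.trans_le ?_
  have hts : (t : ℝ) < s := by
    rw [← ENNReal.ofReal_coe_nnreal] at hts
    exact (ENNReal.ofReal_lt_ofReal_iff_of_nonneg t.2).1 hts
  -- From generation `a` on, the loss `2 ^ (k n + D)` is absorbed by the margin `s - t`; from `b`
  -- on, gaps are at least twice the lengths.
  obtain ⟨a, ha⟩ := exists_nat_one_div_lt (sub_pos.2 hts)
  obtain ⟨b, hb⟩ := exists_nat_ge (1 / (1 - s))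
  set P : ℕ → ℝ := fun n ↦ ∏ i ∈ Finset.range n, (m i : ℝ)⁻¹ with hP
  have hm1 : ∀ n, (1 : ℝ) ≤ m n := fun n ↦ by
    exact_mod_cast Nat.one_le_iff_ne_zero.2 (NeZero.ne (m n))
  have hP0 : ∀ n, 0 ≤ P n := fun n ↦ Finset.prod_nonneg fun i _ ↦ by positivity
  have hP1 : ∀ n, P n ≤ 1 := fun n ↦
    Finset.prod_le_one (fun i _ ↦ by positivity) fun i _ ↦ inv_le_one_of_one_le₀ (hm1 i)
  have hPs : ∀ n, P (n + 1) ≤ P n * (2 / c * 2 ^ (k n : ℝ) * 2 ^ (-(k (n + 1) * s))) := by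
    intro n
    simp only [hP, Finset.prod_range_succ]
    refine mul_le_mul_of_nonneg_left ?_ (hP0 n)
    have hpos : 0 < c * ((2 : ℝ) ^ (-(k n : ℝ)) / 2) * 2 ^ (k (n + 1) * s) := by positivity
    refine (inv_anti₀ hpos (hm n)).trans_eq ?_
    rw [Real.rpow_neg (by norm_num), Real.rpow_neg (by norm_num)]
    field_simp
  have hPt : ∀ n ≥ a, P (n + 1) ≤ (2 ^ (-(k (n + 1) : ℝ))) ^ (t : ℝ) := by
    intro n hn
    have h1 : ((n : ℝ) + 1) * (k n + D) ≤ k (n + 1) := by exact_mod_cast hk n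
    have h2 : (k n : ℝ) + D ≤ k (n + 1) * (s - t) := by
      have h3 : (1 : ℝ) / (n + 1) ≤ s - t :=
        (one_div_le_one_div_of_le (by positivity) (by gcongr)).trans ha.le
      have h4 : (k n : ℝ) + D ≤ k (n + 1) * (1 / (n + 1)) := by
        rw [mul_one_div, le_div_iff₀ (by positivity)]; linarith
      exact h4.trans (by gcongr)
    calc P (n + 1) ≤ 1 * (2 ^ (D : ℝ) * 2 ^ (k n : ℝ) * 2 ^ (-(k (n + 1) * s))) := by
          refine (hPs n).trans ?_
          gcongr
          · exact hP1 n
          · rw [Real.rpow_natCast]; exact hD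
      _ = 2 ^ (D + k n + -(k (n + 1) * s) : ℝ) := by
          rw [one_mul, Real.rpow_add (by norm_num), Real.rpow_add (by norm_num)]
      _ ≤ 2 ^ (-(k (n + 1) : ℝ) * t) :=
          Real.rpow_le_rpow_of_exponent_le (by norm_num) (by nlinarith)
      _ = _ := by rw [Real.rpow_mul (by norm_num)]
  have hδ : StrictAnti fun n ↦ (2 : ℝ) ^ (-(k n : ℝ)) := by
    intro n n' hn
    refine Real.rpow_lt_rpow_of_exponent_lt (by norm_num) ?_
    have : (k n : ℝ) < k n' := by exact_mod_cast hk' hn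
    linarith
  have hkn : ∀ n, n ≤ k n := fun n ↦ hk'.le_apply
  have key := le_dimH_of_measure_Icc_le (A := S) ((branchMeasure m).map (branchLimit e)) ?_
    (t := t) (D := 1 + 4 / c) (ρ := 2 ^ (-(k (a + b + 1) : ℝ))) t.2 (by positivity)
    (by positivity) ?_
  · rwa [ENNReal.ofReal_coe_nnreal] at key
  · rw [Measure.map_apply (measurable_branchLimit e) hS]
    have : branchLimit e ⁻¹' S = univ := eq_univ_of_forall hmem
    simp [this]
  intro y r hr0 hr
  rw [Measure.map_apply (measurable_branchLimit e) measurableSet_Icc]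
  have hex : ∃ N, (2 : ℝ) ^ (-(k N : ℝ)) ≤ r := by
    obtain ⟨N, hN⟩ := exists_pow_lt_of_lt_one hr0 (y := (1 / 2 : ℝ)) (by norm_num)
    refine ⟨N, le_trans ?_ hN.le⟩
    rw [one_div, ← Real.rpow_natCast, Real.inv_rpow (by norm_num), ← Real.rpow_neg (by norm_num)]
    refine Real.rpow_le_rpow_of_exponent_le (by norm_num) ?_
    have : (N : ℝ) ≤ k N := by exact_mod_cast hkn N
    linarith
  classical
  -- Generation `n + 2` is the first whose intervals have length at most `r`; the choice of `ρ`
  -- forces `n ≥ a + b`.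
  obtain ⟨n, hn, hrn, hrn'⟩ : ∃ n ≥ a + b, (2 : ℝ) ^ (-(k (n + 2) : ℝ)) ≤ r ∧
      r < 2 ^ (-(k (n + 1) : ℝ)) := by
    have h1 : a + b + 1 < Nat.find hex := by
      by_contra! hle
      exact absurd (((hδ.antitone hle).trans (Nat.find_spec hex))) (not_le.2 hr)
    obtain ⟨n, hn⟩ := Nat.exists_eq_add_of_le (show 2 ≤ Nat.find hex by omega)
    rw [add_comm] at hn
    refine ⟨n, by omega, hn ▸ Nat.find_spec hex, ?_⟩
    exact not_le.1 (Nat.find_min hex (by omega))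
  refine (h.branchMeasure_Icc_le (n := n) ?_ hrn hrn').trans (ENNReal.ofReal_le_ofReal ?_)
  · have h1 : (b : ℝ) ≤ k (n + 1) := by exact_mod_cast (show b ≤ n + 1 by omega).trans (hkn _)
    have h2 : 1 ≤ k (n + 1) * (1 - s) := by
      rw [div_le_iff₀ (by linarith)] at hb
      nlinarith
    calc (2 : ℝ) * 2 ^ (-(k (n + 1) : ℝ)) = 2 ^ (1 + -(k (n + 1) : ℝ)) := by
          rw [Real.rpow_add (by norm_num), Real.rpow_one]
      _ ≤ _ := Real.rpow_le_rpow_of_exponent_le (by norm_num) (by linarith)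
  · have h1 : P (n + 2) ≤ r ^ (t : ℝ) :=
      (hPt (n + 1) (by omega)).trans (Real.rpow_le_rpow (by positivity) hrn t.2)
    -- The mass per unit length of a generation `n + 1` interval is at most `z ^ (t - 1)`, which is
    -- at most `r ^ (t - 1)` because `r < z` and `t < 1`.
    have h2 : P (n + 1) * 2 ^ (k (n + 1) : ℝ) * r ≤ r ^ (t : ℝ) := by
      set z : ℝ := 2 ^ (-(k (n + 1) : ℝ)) with hz
      have hz0 : 0 < z := by positivity
      have hz1 : (2 : ℝ) ^ (k (n + 1) : ℝ) = z⁻¹ := by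
        rw [hz, Real.rpow_neg (by norm_num), inv_inv]
      rw [hz1]
      have h3 := hPt n (by omega)
      rw [← hz] at h3
      calc P (n + 1) * z⁻¹ * r ≤ z ^ (t : ℝ) * z⁻¹ * r := by gcongr
        _ = z ^ ((t : ℝ) - 1) * r := by rw [Real.rpow_sub_one hz0.ne', div_eq_mul_inv]
        _ ≤ r ^ ((t : ℝ) - 1) * r := by
            refine mul_le_mul_of_nonneg_right ?_ hr0.le
            exact Real.rpow_le_rpow_of_nonpos hr0 hrn'.le (by linarith)
        _ = r ^ (t : ℝ) := by rw [Real.rpow_sub_one hr0.ne']; field_simp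
    have h3 := hPs (n + 1)
    rw [Real.rpow_neg (by norm_num)] at h3
    change (1 + 2 * r / 2 ^ (-(k (n + 2) * s))) * P (n + 2) ≤ _
    rw [Real.rpow_neg (by norm_num), div_inv_eq_mul]
    set w : ℝ := 2 ^ (k (n + 2) * s) with hw
    have hw0 : 0 < w := by positivity
    calc (1 + 2 * r * w) * P (n + 2) = P (n + 2) + 2 * r * w * P (n + 2) := by ring
      _ ≤ r ^ (t : ℝ) + 2 * r * w * (P (n + 1) * (2 / c * 2 ^ (k (n + 1) : ℝ) * w⁻¹)) := by
          gcongr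
      _ = r ^ (t : ℝ) + 4 / c * (P (n + 1) * 2 ^ (k (n + 1) : ℝ) * r) := by
          field_simp; ring
      _ ≤ r ^ (t : ℝ) + 4 / c * r ^ (t : ℝ) := by gcongr
      _ = _ := by ring

/-- If the scales `k` grow fast enough, the limit set of a spread family of exponent `s` has
dimension at least `s`. -/
theorem IsSpread.exists_forall_le_dimH {E : ℕ → Set ℝ} {s c : ℝ} (h : IsSpread E s c)
    (hE : ∀ k, (E k).Countable) (hs : s < 1) (hc : 0 < c) :
    ∃ Φ : ℕ → ℕ → ℕ, ∀ k : ℕ → ℕ, k 0 = 0 → (∀ n, Φ n (k n) ≤ k (n + 1)) →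
      ENNReal.ofReal s ≤ dimH (limitSet E k) := by
  choose! K hK using h.exists_finset
  obtain ⟨D, hD⟩ := pow_unbounded_of_one_lt (2 / c) (one_lt_two (α := ℝ))
  -- The summands ensure, in turn, enough children in half of a parent interval, strict growth of
  -- the scales, and the rapid growth that makes earlier generations negligible.
  refine ⟨fun n k ↦ K (2 ^ (-(k : ℝ)) / 2) + (k + 1) + (n + 1) * (k + D), fun k hk0 hk ↦ ?_⟩
  have hkK : ∀ n, K (2 ^ (-(k n : ℝ)) / 2) ≤ k (n + 1) := fun n ↦ by have := hk n; lia
  have hkg : ∀ n, (n + 1) * (k n + D) ≤ k (n + 1) := fun n ↦ by have := hk n; lia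
  have hks : ∀ n, k n + 1 ≤ k (n + 1) := fun n ↦ by have := hk n; lia
  set m : ℕ → ℕ := fun n ↦ ⌈c * ((2 : ℝ) ^ (-(k n : ℝ)) / 2) * 2 ^ (k (n + 1) * s)⌉₊ with hm
  have hm0 : ∀ n, NeZero (m n) := fun n ↦ ⟨(Nat.ceil_pos.2 (by positivity)).ne'⟩
  have hchild : ∀ n (y : ℝ), ∃ f : Fin (m n) → ℝ, Function.Injective f ∧
      ∀ j, f j ∈ E (k (n + 1)) ∧ f j ∈ Icc y (y + 2 ^ (-(k n : ℝ)) / 2) := by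
    intro n y
    obtain ⟨F, hF, hcard⟩ := hK (2 ^ (-(k n : ℝ)) / 2) (by positivity) _ (hkK n) y
    have hle : m n ≤ F.card := Nat.ceil_le.2 hcard
    refine ⟨fun j ↦ F.equivFin.symm (Fin.castLE hle j), ?_, fun j ↦ hF _ (Subtype.prop _)⟩
    intro i j hij
    exact Fin.castLE_injective hle (F.equivFin.symm.injective (Subtype.ext hij))
  choose e hinj hmemE using hchild
  have hkpos : ∀ n, (1 : ℝ) ≤ k (n + 1) := fun n ↦ by
    exact_mod_cast (show 1 ≤ k n + 1 by omega).trans (hks n)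
  have hbr : IsBranching e (fun n ↦ 2 ^ (-(k n : ℝ))) fun n ↦ 2 ^ (-(k n * s)) := by
    refine ⟨fun n ↦ by positivity, fun n ↦ ?_, fun n y j ↦ (hmemE n y j).2,
      fun n y y' j j' hne ↦ h.separated _ _ (hmemE n y j).1 _ (hmemE n y' j').1 hne, hinj,
      fun n ↦ ?_⟩
    · rw [div_eq_mul_inv, ← Real.rpow_neg_one, ← Real.rpow_add (by norm_num)]
      refine Real.rpow_le_rpow_of_exponent_le (by norm_num) ?_
      have : (k n : ℝ) + 1 ≤ k (n + 1) := by exact_mod_cast hks n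
      linarith
    · refine Real.rpow_lt_rpow_of_exponent_lt (by norm_num) ?_
      nlinarith [hkpos n]
  refine hbr.le_dimH hs hc hD.le (fun n ↦ Nat.le_ceil _) hkg
    (strictMono_nat_of_lt_succ fun n ↦ hks n) (measurableSet_limitSet hE k) fun ω ↦ ⟨?_, ?_⟩
  · simpa [hk0, branchPoint] using hbr.branchLimit_mem_Icc ω 0
  · refine mem_iInter.2 fun n ↦ mem_iUnion₂.2 ⟨_, (hmemE n (branchPoint e ω n) (ω n)).1, ?_⟩
    have h1 := hbr.branchLimit_mem_Icc ω (n + 1)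
    simp only [branchPoint] at h1
    rw [Real.closedBall_eq_Icc]
    exact ⟨by linarith [h1.1, Real.rpow_pos_of_pos (two_pos (α := ℝ)) (-(k (n + 1) : ℝ))], h1.2⟩

/-! ### Fractions of bounded denominator -/

/-- The multiples by `1 / M` of the rationals with denominator at most `Q`. -/
def fractions (M Q : ℕ) : Set ℝ := {x | ∃ r : ℚ, r.den ≤ Q ∧ x = r / M}

theorem countable_fractions (M Q : ℕ) : (fractions M Q).Countable := by
  refine (countable_range fun r : ℚ ↦ (r : ℝ) / M).mono ?_
  rintro x ⟨r, -, rfl⟩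
  exact ⟨r, rfl⟩

theorem le_abs_sub_of_mem_fractions {M Q : ℕ} (hM : 0 < M) {x y : ℝ} (hx : x ∈ fractions M Q)
    (hy : y ∈ fractions M Q) (hne : x ≠ y) : 1 / (M * Q ^ 2 : ℝ) ≤ |x - y| := by
  obtain ⟨r, hr, rfl⟩ := hx
  obtain ⟨r', hr', rfl⟩ := hy
  have hM' : (0 : ℝ) < M := by exact_mod_cast hM
  have hd : (0 : ℝ) < r.den := by exact_mod_cast r.pos
  have hd' : (0 : ℝ) < r'.den := by exact_mod_cast r'.pos
  have hQ : (r.den : ℝ) ≤ Q := by exact_mod_cast hr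
  have hQ' : (r'.den : ℝ) ≤ Q := by exact_mod_cast hr'
  have hsub : (r : ℝ) / M - r' / M =
      ((r.num * r'.den - r'.num * r.den : ℤ) : ℝ) / (M * (r.den * r'.den)) := by
    rw [Rat.cast_def r, Rat.cast_def r']
    push_cast
    field_simp
  have hz : r.num * r'.den - r'.num * r.den ≠ 0 := by
    intro h0
    rw [h0] at hsub
    simp only [Int.cast_zero, zero_div] at hsub
    exact hne (sub_eq_zero.1 hsub)
  have h1 : (1 : ℝ) ≤ |((r.num * r'.den - r'.num * r.den : ℤ) : ℝ)| := by
    rw [← Int.cast_abs]; exact_mod_cast Int.one_le_abs hz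
  rw [hsub, abs_div, abs_of_pos (show (0 : ℝ) < M * (r.den * r'.den) by positivity)]
  gcongr
  rw [sq]
  gcongr

/-- A crude substitute for the logarithmic bound; it costs only the condition `32 ≤ L * √Q` in the
count of rationals. -/
theorem sum_inv_le_two_mul_sqrt (n : ℕ) : ∑ q ∈ Finset.Icc 1 n, (q : ℝ)⁻¹ ≤ 2 * √n := by
  induction n with
  | zero => simp
  | succ n ih =>
    rw [Finset.sum_Icc_succ_top (by omega)]
    have h0 : 0 ≤ √(n : ℝ) := Real.sqrt_nonneg _
    have h1 : 0 < √((n : ℝ) + 1) := by positivity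
    have h2 : √(n : ℝ) ^ 2 = n := Real.sq_sqrt (by positivity)
    have h3 : √((n : ℝ) + 1) ^ 2 = n + 1 := Real.sq_sqrt (by positivity)
    have h4 : ((n : ℝ) + 1)⁻¹ ≤ 2 * √((n : ℝ) + 1) - 2 * √(n : ℝ) := by
      have h5 : √(n : ℝ) ≤ √((n : ℝ) + 1) := Real.sqrt_le_sqrt (by linarith)
      have h6 : (1 : ℝ) ≤ √((n : ℝ) + 1) := Real.one_le_sqrt.2
        (by linarith [n.cast_nonneg (α := ℝ)])
      have h7 : 1 ≤ (2 * √((n : ℝ) + 1) - 2 * √(n : ℝ)) * √((n : ℝ) + 1) := by nlinarith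
      rw [inv_le_iff_one_le_mul₀ (by positivity), ← h3, Real.sqrt_sq h1.le]
      nlinarith
    push_cast
    linarith

theorem card_Icc_ceil_floor_le {a b : ℝ} (hab : a ≤ b) :
    ((Finset.Icc ⌈a⌉ ⌊b⌋).card : ℝ) ≤ b - a + 1 := by
  rw [Int.card_Icc]
  have h1 := Int.floor_le b
  have h2 := Int.le_ceil a
  rcases le_total 0 (⌊b⌋ + 1 - ⌈a⌉) with h | h
  · have : (((⌊b⌋ + 1 - ⌈a⌉).toNat : ℤ) : ℝ) = ((⌊b⌋ + 1 - ⌈a⌉ : ℤ) : ℝ) := by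
      rw [Int.toNat_of_nonneg h]
    rw [Int.cast_natCast] at this
    rw [this]
    push_cast
    linarith
  · rw [Int.toNat_of_nonpos h]
    simp; linarith

theorem den_intCast_div_natCast_le (p : ℤ) {q : ℕ} (hq : 0 < q) : ((p : ℚ) / q).den ≤ q := by
  have h := Rat.den_dvd p q
  rw [Rat.divInt_eq_div] at h
  exact Nat.le_of_dvd hq (by exact_mod_cast h)

/-- An interval of length `L` contains a positive proportion of the maximal possible number
`L Q ^ 2` of rationals with denominator at most `Q`. -/
theorem exists_finset_rat_den_le {Q : ℕ} (hQ : 0 < Q) {x L : ℝ} (hL : 32 ≤ L * √Q) :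
    ∃ F : Finset ℚ, (∀ r ∈ F, r.den ≤ Q ∧ (r : ℝ) ∈ Icc x (x + L)) ∧
      L * Q ^ 2 / 128 ≤ F.card := by
  classical
  have hQ' : (0 : ℝ) < Q := by exact_mod_cast hQ
  have hQ1 : (1 : ℝ) ≤ Q := by exact_mod_cast hQ
  have hsq : √(Q : ℝ) ^ 2 = Q := Real.sq_sqrt hQ'.le
  have hsq0 : 0 < √(Q : ℝ) := Real.sqrt_pos.2 hQ'
  have hsq1 : 1 ≤ √(Q : ℝ) := Real.one_le_sqrt.2 hQ1
  have hL0 : 0 < L := by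
    by_contra! h
    nlinarith
  set S : ℕ → Finset ℤ := fun q ↦ Finset.Icc ⌈(q : ℝ) * x⌉ ⌊(q : ℝ) * (x + L)⌋ with hS
  have hScard : ∀ q, ((S q).card : ℝ) ≤ q * L + 1 := fun q ↦ by
    refine (card_Icc_ceil_floor_le (by gcongr; linarith)).trans_eq ?_
    ring
  set F : Finset ℚ := (Finset.Icc 1 Q).biUnion fun q ↦ (S q).image fun p : ℤ ↦ (p : ℚ) / q with hF
  have hmemS : ∀ r : ℚ, (r : ℝ) ∈ Icc x (x + L) → r.num ∈ S r.den := by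
    intro r hr
    have hd : (0 : ℝ) < r.den := by exact_mod_cast r.pos
    have hnum : (r.num : ℝ) = r.den * r := by
      rw [Rat.cast_def r]; field_simp
    rw [hS, Finset.mem_Icc, Int.ceil_le, Int.le_floor, hnum]
    exact ⟨by gcongr; exact hr.1, by gcongr; exact hr.2⟩
  refine ⟨F, ?_, ?_⟩
  · intro r hr
    obtain ⟨q, hq, hr⟩ := Finset.mem_biUnion.1 hr
    obtain ⟨p, hp, rfl⟩ := Finset.mem_image.1 hr
    rw [Finset.mem_Icc] at hq
    rw [hS, Finset.mem_Icc, Int.ceil_le, Int.le_floor] at hp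
    have hq0 : (0 : ℝ) < q := by exact_mod_cast hq.1
    refine ⟨(den_intCast_div_natCast_le p hq.1).trans hq.2, ?_⟩
    push_cast
    exact ⟨by rw [le_div_iff₀ hq0]; linarith [hp.1], by rw [div_le_iff₀ hq0]; linarith [hp.2]⟩
  -- Dirichlet approximates each point of the middle half by a rational that stays in `[x, x + L]`.
  -- Denominators at most `Q / 16` account for measure at most `L / 4` (`hsum`); the others give
  -- balls of radius at most `16 / Q ^ 2`, which must cover the remaining `L / 4`.
  have hcover : Icc (x + L / 4) (x + 3 * L / 4) ⊆
      (⋃ q ∈ Finset.Icc 1 (Q / 16), ⋃ p ∈ S q, closedBall ((p : ℝ) / q) (1 / (Q * q))) ∪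
        ⋃ r ∈ F, closedBall (r : ℝ) (16 / Q ^ 2) := by
    intro ξ hξ
    obtain ⟨r, hr, hrQ⟩ := Real.exists_rat_abs_sub_le_and_den_le ξ hQ
    have hd : (0 : ℝ) < r.den := by exact_mod_cast r.pos
    have hd1 : (1 : ℝ) ≤ r.den := by exact_mod_cast r.pos
    have hr1 : |ξ - r| ≤ 1 / (Q * r.den) := hr.trans (by gcongr; linarith)
    have hr2 : |ξ - r| ≤ L / 4 := by
      refine hr1.trans ?_
      rw [div_le_iff₀ (by positivity)]
      have h1 : L * √Q ≤ L * Q := by gcongr; nlinarith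
      have h2 : L * Q * 1 ≤ L * Q * r.den := by gcongr
      nlinarith
    have hrI : (r : ℝ) ∈ Icc x (x + L) := by
      rw [abs_le] at hr2
      constructor <;> linarith [hξ.1, hξ.2]
    have hrS := hmemS r hrI
    by_cases hsmall : r.den ≤ Q / 16
    · left
      refine mem_iUnion₂.2 ⟨r.den, Finset.mem_Icc.2 ⟨r.pos, hsmall⟩,
        mem_iUnion₂.2 ⟨r.num, hrS, ?_⟩⟩
      rw [mem_closedBall, Real.dist_eq, ← Rat.cast_def]
      exact hr1
    · right
      refine mem_iUnion₂.2 ⟨r, Finset.mem_biUnion.2 ⟨r.den, Finset.mem_Icc.2 ⟨r.pos, hrQ⟩,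
        Finset.mem_image.2 ⟨r.num, hrS, Rat.num_div_den r⟩⟩, ?_⟩
      rw [mem_closedBall, Real.dist_eq]
      refine hr1.trans ?_
      have h1 : Q < 16 * r.den := by omega
      have h2 : (Q : ℝ) < 16 * r.den := by exact_mod_cast h1
      rw [div_le_div_iff₀ (by positivity) (by positivity)]
      nlinarith
  have hvol : ENNReal.ofReal (L / 2) ≤ ENNReal.ofReal
      (∑ q ∈ Finset.Icc 1 (Q / 16), ((S q).card : ℝ) * (2 * (1 / (Q * q))) +
        F.card * (2 * (16 / Q ^ 2))) := by
    have h1 : volume (Icc (x + L / 4) (x + 3 * L / 4)) = ENNReal.ofReal (L / 2) := by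
      rw [Real.volume_Icc]; congr 1; ring
    rw [← h1, ENNReal.ofReal_add (Finset.sum_nonneg fun _ _ ↦ by positivity) (by positivity),
      ENNReal.ofReal_sum_of_nonneg (fun _ _ ↦ by positivity)]
    refine (measure_mono hcover).trans ((measure_union_le _ _).trans (add_le_add ?_ ?_))
    · refine (measure_biUnion_finset_le _ _).trans (Finset.sum_le_sum fun q _ ↦ ?_)
      refine (measure_biUnion_finset_le _ _).trans_eq ?_
      simp only [Real.volume_closedBall, Finset.sum_const, nsmul_eq_mul]
      rw [← ENNReal.ofReal_natCast, ← ENNReal.ofReal_mul (by positivity)]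
    · refine (measure_biUnion_finset_le _ _).trans_eq ?_
      simp only [Real.volume_closedBall, Finset.sum_const, nsmul_eq_mul]
      rw [← ENNReal.ofReal_natCast, ← ENNReal.ofReal_mul (by positivity)]
  rw [ENNReal.ofReal_le_ofReal_iff
    (add_nonneg (Finset.sum_nonneg fun _ _ ↦ by positivity) (by positivity))] at hvol
  have hsum : ∑ q ∈ Finset.Icc 1 (Q / 16), ((S q).card : ℝ) * (2 * (1 / (Q * q))) ≤ L / 4 := by
    calc ∑ q ∈ Finset.Icc 1 (Q / 16), ((S q).card : ℝ) * (2 * (1 / (Q * q)))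
        ≤ ∑ q ∈ Finset.Icc 1 (Q / 16), (2 * L / Q + 2 / Q * (q : ℝ)⁻¹) := by
          refine Finset.sum_le_sum fun q hq ↦ ?_
          have hq0 : (0 : ℝ) < q := by exact_mod_cast (Finset.mem_Icc.1 hq).1
          calc ((S q).card : ℝ) * (2 * (1 / (Q * q))) ≤ (q * L + 1) * (2 * (1 / (Q * q))) := by
                gcongr; exact hScard q
            _ = _ := by field_simp
      _ = ((Q / 16 : ℕ) : ℝ) * (2 * L / Q) +
            2 / Q * ∑ q ∈ Finset.Icc 1 (Q / 16), (q : ℝ)⁻¹ := by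
          rw [Finset.sum_add_distrib, Finset.sum_const, Nat.card_Icc, nsmul_eq_mul,
            ← Finset.mul_sum]
          simp
      _ ≤ (Q / 16 : ℝ) * (2 * L / Q) + 2 / Q * (2 * √Q) := by
          have h1 : ((Q / 16 : ℕ) : ℝ) ≤ Q / 16 := by exact_mod_cast Nat.cast_div_le
          have h2 : ((Q / 16 : ℕ) : ℝ) ≤ Q := h1.trans (by linarith)
          gcongr
          exact (sum_inv_le_two_mul_sqrt _).trans (by gcongr)
      _ = L / 8 + 4 / √Q := by
          have h1 : 2 / (Q : ℝ) * (2 * √Q) = 4 / √Q := by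
            rw [div_mul_eq_mul_div, div_eq_div_iff hQ'.ne' hsq0.ne']
            linear_combination 4 * hsq
          rw [h1]
          field_simp
          ring
      _ ≤ L / 4 := by
          have : 4 / √(Q : ℝ) ≤ L / 8 := by
            rw [div_le_div_iff₀ hsq0 (by norm_num)]; linarith
          linarith
  have hfin : L / 4 ≤ F.card * (2 * (16 / Q ^ 2)) := by linarith
  have h1 : (F.card : ℝ) * (2 * (16 / Q ^ 2)) = F.card * 32 / Q ^ 2 := by ring
  rw [h1, div_le_div_iff₀ (by norm_num) (by positivity)] at hfin
  linarith

/-- Scaling by `M k` turns an interval of length `ℓ` into one of length `M k * ℓ`, where rationals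
of denominator at most `Q k` are counted; `htop` makes it long enough for that count. -/
theorem isSpread_fractions {M Q : ℕ → ℕ} {s c : ℝ} (hM : ∀ k, 0 < M k) (hQ : ∀ k, 0 < Q k)
    (hle : ∀ k, (M k * Q k ^ 2 : ℝ) ≤ 2 ^ (k * s))
    (hge : ∀ k : ℕ, c * 2 ^ (k * s) ≤ (M k * Q k ^ 2 : ℝ))
    (htop : Tendsto (fun k ↦ M k * √(Q k : ℝ)) atTop atTop) :
    IsSpread (fun k ↦ fractions (M k) (Q k)) s (c / 128) where
  separated k x hx y hy hne := by
    have h1 : (0 : ℝ) < M k := by exact_mod_cast hM k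
    have h2 : (0 : ℝ) < Q k := by exact_mod_cast hQ k
    refine le_trans ?_ (le_abs_sub_of_mem_fractions (hM k) hx hy hne)
    rw [Real.rpow_neg (by norm_num), ← one_div]
    exact one_div_le_one_div_of_le (by positivity) (hle k)
  exists_finset ℓ hℓ := by
    classical
    obtain ⟨K, hK⟩ := eventually_atTop.1 (htop.eventually_ge_atTop (32 / ℓ))
    refine ⟨K, fun k hk x ↦ ?_⟩
    have h1 : (0 : ℝ) < M k := by exact_mod_cast hM k
    obtain ⟨F, hF, hcard⟩ := exists_finset_rat_den_le (hQ k) (x := M k * x) (L := M k * ℓ) (by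
      have := hK k hk
      rw [div_le_iff₀ hℓ] at this
      linarith)
    refine ⟨F.image fun r : ℚ ↦ (r : ℝ) / M k, ?_, ?_⟩
    · intro z hz
      obtain ⟨r, hr, rfl⟩ := Finset.mem_image.1 hz
      obtain ⟨hd, hr1, hr2⟩ := hF r hr
      exact ⟨⟨r, hd, rfl⟩, by rw [le_div_iff₀ h1]; linarith, by rw [div_le_iff₀ h1]; linarith⟩
    · rw [Finset.card_image_of_injective]
      · refine le_trans ?_ hcard
        nlinarith [mul_le_mul_of_nonneg_left (hge k) hℓ.le]
      · intro r r' h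
        have := (div_left_inj' h1.ne').1 h
        exact_mod_cast this

/-- The window `[-1, 2]` contains every fraction within distance `1` of the unit interval. -/
theorem exists_finset_fractions_subset {M Q : ℕ} (hM : 0 < M) (hQ : 0 < Q) :
    ∃ F : Finset ℝ, (F.card : ℝ) ≤ 4 * (M * Q ^ 2) ∧
      ∀ z ∈ fractions M Q, z ∈ Icc (-1) 2 → z ∈ F := by
  classical
  refine ⟨(Finset.Icc 1 Q).biUnion fun q ↦
    (Finset.Icc (-(q * M : ℤ)) (2 * (q * M))).image fun p : ℤ ↦ (p : ℝ) / (q * M), ?_, ?_⟩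
  · have h : ((Finset.Icc 1 Q).biUnion fun q : ℕ ↦
        (Finset.Icc (-(q * M : ℤ)) (2 * (q * M))).image fun p : ℤ ↦ (p : ℝ) / (q * M)).card ≤
        (Finset.Icc 1 Q).card * (4 * (M * Q)) := by
      refine Finset.card_biUnion_le_card_mul _ _ _ fun q hq ↦ Finset.card_image_le.trans ?_
      rw [Finset.mem_Icc] at hq
      rw [Int.card_Icc]
      have h1 : q * M ≤ M * Q := by rw [mul_comm]; gcongr; exact hq.2
      have h2 : 1 ≤ M * Q := Nat.mul_pos hM hQ
      zify at h1 h2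
      rw [Int.toNat_le]
      push_cast
      linarith
    rw [Nat.card_Icc, Nat.add_sub_cancel] at h
    calc _ ≤ ((Q * (4 * (M * Q)) : ℕ) : ℝ) := by exact_mod_cast h
      _ = _ := by push_cast; ring
  · rintro z ⟨r, hr, rfl⟩ ⟨h1, h2⟩
    have hM' : (0 : ℝ) < M := by exact_mod_cast hM
    have hd : (0 : ℝ) < r.den := by exact_mod_cast r.pos
    have hr' : (r : ℝ) / M = r.num / (r.den * M) := by
      nth_rewrite 1 [Rat.cast_def r]
      rw [div_div]
    refine Finset.mem_biUnion.2 ⟨r.den, Finset.mem_Icc.2 ⟨r.pos, hr⟩,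
      Finset.mem_image.2 ⟨r.num, ?_, hr'.symm⟩⟩
    rw [hr', le_div_iff₀ (by positivity)] at h1
    rw [hr', div_le_iff₀ (by positivity)] at h2
    rw [Finset.mem_Icc]
    constructor
    · have : (-(r.den * M) : ℝ) ≤ r.num := by linarith
      exact_mod_cast this
    · exact_mod_cast h2

theorem dimH_limitSet_fractions_le {M Q : ℕ → ℕ} {s : ℝ} (hs : 0 ≤ s) (hM : ∀ k, 0 < M k)
    (hQ : ∀ k, 0 < Q k) (hle : ∀ k, (M k * Q k ^ 2 : ℝ) ≤ 2 ^ (k * s)) {k : ℕ → ℕ}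
    (hk : ∀ n, n ≤ k n) :
    dimH (limitSet (fun k ↦ fractions (M k) (Q k)) k) ≤ ENNReal.ofReal s := by
  refine dimH_le_of_frequently_cover (D := 4) hs (by norm_num) fun N ↦ ⟨k (N + 1), ?_, ?_⟩
  · exact (Nat.le_succ N).trans (hk _)
  obtain ⟨F, hcard, hF⟩ := exists_finset_fractions_subset (hM (k (N + 1))) (hQ (k (N + 1)))
  refine ⟨F, hcard.trans (by gcongr; exact hle _), fun z hz ↦ ?_⟩
  obtain ⟨w, hw, hzw⟩ := mem_iUnion₂.1 (mem_iInter.1 hz.2 N)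
  have h1 : (2 : ℝ) ^ (-(k (N + 1) : ℝ)) ≤ 1 :=
    Real.rpow_le_one_of_one_le_of_nonpos (by norm_num) (by simp)
  have h0 : (0 : ℝ) < 2 ^ (-(k (N + 1) : ℝ)) := by positivity
  have h2 := hzw
  rw [mem_closedBall, Real.dist_eq, abs_le] at h2
  refine mem_iUnion₂.2 ⟨w, hF w hw ?_, closedBall_subset_closedBall (by linarith) hzw⟩
  constructor <;> linarith [hz.1.1, hz.1.2]

theorem exists_int_of_mem_fractions_one {M : ℕ} {x : ℝ} (hx : x ∈ fractions M 1) :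
    ∃ i : ℤ, x = i / M := by
  obtain ⟨r, hr, rfl⟩ := hx
  refine ⟨r.num, ?_⟩
  have hd : r.den = 1 := le_antisymm hr r.pos
  nth_rewrite 1 [Rat.cast_def r]
  simp [hd]

/-! ### Covers of the sums `A + c B` -/

/-- If `c` is close to `p / (q M)`, the sums `a + c b` with `a` and `b` close to multiples of
`1 / (M N)` and `1 / N` are close to multiples of `1 / (q M N)`. -/
theorem exists_finset_add_mul_mem_of_fractions {M N Q : ℕ} (hM : 0 < M) (hN : 0 < N) {δ c w : ℝ}
    (hδ : δ ≤ 1) (hc : c ∈ Icc 0 1) (hw : w ∈ fractions M Q) (hcw : c ∈ closedBall w δ) :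
    ∃ F : Finset ℝ, (F.card : ℝ) ≤ 13 * (M * N * Q) ∧
      ∀ a ∈ Icc (0 : ℝ) 1, ∀ b ∈ Icc (0 : ℝ) 1,
        ∀ u ∈ fractions (M * N) 1, a ∈ closedBall u δ →
        ∀ v ∈ fractions N 1, b ∈ closedBall v δ → a + c * b ∈ ⋃ y ∈ F, closedBall y (4 * δ) := by
  classical
  obtain ⟨r, hr, rfl⟩ := hw
  have hM' : (0 : ℝ) < M := by exact_mod_cast hM
  have hN' : (0 : ℝ) < N := by exact_mod_cast hN
  have hd : (0 : ℝ) < r.den := by exact_mod_cast r.pos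
  set R : ℕ := M * N * r.den with hR
  have hR0 : 0 < R := Nat.mul_pos (Nat.mul_pos hM hN) r.pos
  have hR' : (0 : ℝ) < R := by exact_mod_cast hR0
  -- The approximants `u`, `v`, `w` are at most `2` in absolute value, so `|u + w * v| ≤ 6`; the `12
  -- * R + 1` grid points give the constant `13`.
  refine ⟨(Finset.Icc (-(6 * R : ℤ)) (6 * R)).image fun z : ℤ ↦ (z : ℝ) / R, ?_, ?_⟩
  · have h1 : ((Finset.Icc (-(6 * R : ℤ)) (6 * R)).image fun z : ℤ ↦ (z : ℝ) / R).card ≤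
        13 * (M * N * Q) := by
      refine Finset.card_image_le.trans ?_
      have h2 : R ≤ M * N * Q := by rw [hR]; gcongr
      rw [Int.card_Icc]
      omega
    exact_mod_cast h1
  · intro a ha b hb u hu hau v hv hbv
    obtain ⟨i, rfl⟩ := exists_int_of_mem_fractions_one hu
    obtain ⟨j, rfl⟩ := exists_int_of_mem_fractions_one hv
    have hsum : (i : ℝ) / (M * N : ℕ) + r / M * (j / N) =
        ((i * r.den + r.num * j : ℤ) : ℝ) / R := by
      rw [hR, Rat.cast_def r]
      push_cast
      field_simp
    set u : ℝ := (i : ℝ) / (M * N : ℕ)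
    set v : ℝ := (j : ℝ) / N
    set w : ℝ := (r : ℝ) / M
    rw [mem_closedBall, Real.dist_eq] at hau hbv hcw
    have hδ0 : 0 ≤ δ := (abs_nonneg _).trans hau
    have hu2 : |u| ≤ 2 := by
      rw [abs_le] at hau ⊢; constructor <;> linarith [ha.1, ha.2]
    have hv2 : |v| ≤ 2 := by
      rw [abs_le] at hbv ⊢; constructor <;> linarith [hb.1, hb.2]
    have hw2 : |w| ≤ 2 := by
      rw [abs_le] at hcw ⊢; constructor <;> linarith [hc.1, hc.2]
    have hsix : |u + w * v| ≤ 6 := by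
      refine (abs_add_le _ _).trans ?_
      rw [abs_mul]
      nlinarith [abs_nonneg w, abs_nonneg v]
    refine mem_iUnion₂.2 ⟨u + w * v, Finset.mem_image.2 ⟨_, ?_, hsum.symm⟩, ?_⟩
    · rw [hsum, abs_div, abs_of_pos hR', div_le_iff₀ hR'] at hsix
      rw [Finset.mem_Icc, ← abs_le]
      exact_mod_cast hsix
    · rw [mem_closedBall, Real.dist_eq]
      -- The three errors are at most `δ`, `δ` and `2 * δ`, as `c ≤ 1` and `|v| ≤ 2`.
      have h1 : a + c * b - (u + w * v) = (a - u) + c * (b - v) + (c - w) * v := by ring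
      rw [h1]
      refine (abs_add_three _ _ _).trans ?_
      rw [abs_mul, abs_mul, abs_of_nonneg hc.1]
      have h2 : c * |b - v| ≤ 1 * δ := by gcongr; exact hc.2
      have h3 : |c - w| * |v| ≤ δ * 2 := by gcongr
      linarith

/-- Counts all pairs of approximants, with no arithmetic condition on `c`; this gives the bound `sA
+ sB`. -/
theorem exists_finset_add_mul_mem {M N : ℕ} (hM : 0 < M) (hN : 0 < N) {δ c : ℝ}
    (hδ : δ ≤ 1) (hc : c ∈ Icc 0 1) :
    ∃ F : Finset ℝ, (F.card : ℝ) ≤ 16 * (M * N) ∧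
      ∀ a ∈ Icc (0 : ℝ) 1, ∀ b ∈ Icc (0 : ℝ) 1,
        ∀ u ∈ fractions M 1, a ∈ closedBall u δ →
        ∀ v ∈ fractions N 1, b ∈ closedBall v δ → a + c * b ∈ ⋃ y ∈ F, closedBall y (2 * δ) := by
  classical
  obtain ⟨F, hFc, hF⟩ := exists_finset_fractions_subset hM one_pos
  obtain ⟨G, hGc, hG⟩ := exists_finset_fractions_subset hN one_pos
  refine ⟨Finset.image₂ (fun u v ↦ u + c * v) F G, ?_, ?_⟩
  · have h1 : ((Finset.image₂ (fun u v ↦ u + c * v) F G).card : ℝ) ≤ F.card * G.card := by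
      exact_mod_cast Finset.card_image₂_le _ F G
    refine h1.trans ((mul_le_mul hFc hGc (by positivity) (by positivity)).trans_eq ?_)
    push_cast
    ring
  · intro a ha b hb u hu hau v hv hbv
    rw [mem_closedBall, Real.dist_eq] at hau hbv
    have hu' : u ∈ F := hF u hu (by
      rw [abs_le] at hau; constructor <;> linarith [ha.1, ha.2])
    have hv' : v ∈ G := hG v hv (by
      rw [abs_le] at hbv; constructor <;> linarith [hb.1, hb.2])
    refine mem_iUnion₂.2 ⟨u + c * v, Finset.mem_image₂_of_mem hu' hv', ?_⟩
    rw [mem_closedBall, Real.dist_eq]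
    have h1 : a + c * b - (u + c * v) = (a - u) + c * (b - v) := by ring
    rw [h1]
    refine (abs_add_le _ _).trans ?_
    rw [abs_mul, abs_of_nonneg hc.1]
    have h2 : c * |b - v| ≤ 1 * δ := mul_le_mul hc.2 hbv (abs_nonneg _) zero_le_one
    linarith

/-! ### Choice of the grids and conclusion -/

/-- The integer part of `2 ^ (k u)`. -/
noncomputable def floorPow (u : ℝ) (k : ℕ) : ℕ := ⌊(2 : ℝ) ^ (k * u)⌋₊

theorem floorPow_le (u : ℝ) (k : ℕ) : (floorPow u k : ℝ) ≤ 2 ^ (k * u) :=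
  Nat.floor_le (by positivity)

theorem floorPow_pos {u : ℝ} (hu : 0 ≤ u) (k : ℕ) : 0 < floorPow u k :=
  Nat.floor_pos.2 (Real.one_le_rpow (by norm_num) (by positivity))

theorem le_floorPow {u : ℝ} (hu : 0 ≤ u) (k : ℕ) : 2 ^ (k * u) / 2 ≤ (floorPow u k : ℝ) := by
  have h1 := Nat.lt_floor_add_one ((2 : ℝ) ^ (k * u))
  have h2 : (1 : ℝ) ≤ floorPow u k := by exact_mod_cast floorPow_pos hu k
  simp only [floorPow] at *
  linarith

theorem tendsto_floorPow {u : ℝ} (hu : 0 < u) :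
    Tendsto (fun k ↦ (floorPow u k : ℝ)) atTop atTop := by
  refine tendsto_atTop_mono (le_floorPow hu.le) (Tendsto.atTop_div_const (by norm_num) ?_)
  exact (tendsto_rpow_atTop_of_base_gt_one 2 (by norm_num)).comp
    (tendsto_natCast_atTop_atTop.atTop_mul_const hu)

theorem theorem1p2 (sA sB sC : ℝ)
    (hA : sA ∈ Set.Ioo (0 : ℝ) 1) (hB : sB ∈ Set.Ioo (0 : ℝ) 1) (hC : sC ∈ Set.Ioo (0 : ℝ) 1)
    (hCAB : sC > sA - sB) (hAB : sA - sB ≥ 0) :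
    ∃ A B C : Set ℝ,
      MeasurableSet A ∧ MeasurableSet B ∧ MeasurableSet C ∧
      dimH A = ENNReal.ofReal sA ∧ dimH B = ENNReal.ofReal sB ∧ dimH C = ENNReal.ofReal sC ∧
      ∀ c ∈ C, dimH (A + c • B) ≤
        ENNReal.ofReal (min ((sA + sB + sC) / 2) (min (sA + sB) 1)) := by
  set M : ℕ → ℕ := floorPow (sA - sB) with hMdef
  set N : ℕ → ℕ := floorPow sB with hNdef
  set Q : ℕ → ℕ := floorPow ((sC - (sA - sB)) / 2) with hQdef
  have hQe : 0 < (sC - (sA - sB)) / 2 := by linarith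
  have hM : ∀ k, 0 < M k := floorPow_pos hAB
  have hN : ∀ k, 0 < N k := floorPow_pos hB.1.le
  have hQ : ∀ k, 0 < Q k := floorPow_pos hQe.le
  have hMN : ∀ k, 0 < M k * N k := fun k ↦ Nat.mul_pos (hM k) (hN k)
  have hM1 : ∀ k, (1 : ℝ) ≤ M k := fun k ↦ by exact_mod_cast hM k
  have hA2 : ∀ k : ℕ, (2 : ℝ) ^ (k * sA) = 2 ^ (k * (sA - sB)) * 2 ^ (k * sB) := fun k ↦ by
    rw [← Real.rpow_add (by norm_num)]; congr 1; ring
  have hC2 : ∀ k : ℕ, (2 : ℝ) ^ (k * sC) =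
      2 ^ (k * (sA - sB)) * (2 ^ (k * ((sC - (sA - sB)) / 2))) ^ 2 := fun k ↦ by
    rw [← Real.rpow_natCast, ← Real.rpow_mul (by norm_num), ← Real.rpow_add (by norm_num)]
    congr 1; push_cast; ring
  have hAle : ∀ k : ℕ, (((M k * N k : ℕ) : ℝ) * ((1 : ℕ) : ℝ) ^ 2) ≤ 2 ^ (k * sA) := fun k ↦ by
    rw [hA2]; push_cast; rw [one_pow, mul_one]
    gcongr <;> exact floorPow_le _ _
  have hBle : ∀ k : ℕ, ((N k : ℝ) * ((1 : ℕ) : ℝ) ^ 2) ≤ 2 ^ (k * sB) := fun k ↦ by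
    push_cast; rw [one_pow, mul_one]; exact floorPow_le _ _
  have hCle : ∀ k : ℕ, ((M k : ℝ) * (Q k : ℝ) ^ 2) ≤ 2 ^ (k * sC) := fun k ↦ by
    rw [hC2]; gcongr <;> exact floorPow_le _ _
  have hNtop : Tendsto (fun k ↦ (N k : ℝ)) atTop atTop := tendsto_floorPow hB.1
  -- Each rounded factor loses at most `2`: two factors here, one for `B`, and three for `C`, where
  -- `Q` is squared.
  have hAs : IsSpread (fun k ↦ fractions (M k * N k) 1) sA (1 / 4 / 128) := by
    refine isSpread_fractions (M := fun k ↦ M k * N k) (Q := fun _ ↦ 1) hMN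
      (fun _ ↦ one_pos) hAle (fun k ↦ ?_) ?_
    · have := mul_le_mul (le_floorPow hAB k) (le_floorPow hB.1.le k) (by positivity)
        (by positivity)
      rw [hA2]; push_cast; rw [one_pow, mul_one]
      linarith
    · refine tendsto_atTop_mono (fun k ↦ ?_) hNtop
      push_cast
      rw [Real.sqrt_one, mul_one]
      exact le_mul_of_one_le_left (by positivity) (hM1 k)
  have hBs : IsSpread (fun k ↦ fractions (N k) 1) sB (1 / 2 / 128) := by
    refine isSpread_fractions (M := N) (Q := fun _ ↦ 1) hN (fun _ ↦ one_pos) hBle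
      (fun k ↦ ?_) ?_
    · have := le_floorPow hB.1.le k
      push_cast; rw [one_pow, mul_one]
      linarith
    · simpa using hNtop
  have hCs : IsSpread (fun k ↦ fractions (M k) (Q k)) sC (1 / 8 / 128) := by
    refine isSpread_fractions hM hQ hCle (fun k ↦ ?_) ?_
    · have h1 := pow_le_pow_left₀ (by positivity) (le_floorPow hQe.le k) 2
      have := mul_le_mul (le_floorPow hAB k) h1 (by positivity) (by positivity)
      rw [hC2]
      linarith
    -- If `sA = sB` then `M` is constantly `1`, so the growth must come from `Q`, through the strict
    -- inequality `sC > sA - sB`.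
    · refine tendsto_atTop_mono (fun k ↦ ?_)
        (Real.tendsto_sqrt_atTop.comp (tendsto_floorPow hQe))
      exact le_mul_of_one_le_left (Real.sqrt_nonneg _) (hM1 k)
  obtain ⟨ΦA, hΦA⟩ := hAs.exists_forall_le_dimH (fun k ↦ countable_fractions _ _) hA.2 (by norm_num)
  obtain ⟨ΦB, hΦB⟩ := hBs.exists_forall_le_dimH (fun k ↦ countable_fractions _ _) hB.2 (by norm_num)
  obtain ⟨ΦC, hΦC⟩ := hCs.exists_forall_le_dimH (fun k ↦ countable_fractions _ _) hC.2 (by norm_num)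
  -- One sequence serves all three sets, since the sumset cover uses their approximations at the
  -- same scale.
  obtain ⟨k, hk0, hks⟩ : ∃ k : ℕ → ℕ, k 0 = 0 ∧
      ∀ n, k (n + 1) = ΦA n (k n) + ΦB n (k n) + ΦC n (k n) + (k n + 1) :=
    ⟨fun n ↦ Nat.rec 0 (fun n k ↦ ΦA n k + ΦB n k + ΦC n k + (k + 1)) n, rfl, fun _ ↦ rfl⟩
  have hkn : ∀ n, n ≤ k n := by
    intro n
    induction n with
    | zero => simp
    | succ n ih => rw [hks]; omega
  refine ⟨limitSet (fun k ↦ fractions (M k * N k) 1) k, limitSet (fun k ↦ fractions (N k) 1) k,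
    limitSet (fun k ↦ fractions (M k) (Q k)) k,
    measurableSet_limitSet (fun _ ↦ countable_fractions _ _) k,
    measurableSet_limitSet (fun _ ↦ countable_fractions _ _) k,
    measurableSet_limitSet (fun _ ↦ countable_fractions _ _) k,
    le_antisymm (dimH_limitSet_fractions_le hA.1.le hMN (fun _ ↦ one_pos) hAle hkn)
      (hΦA k hk0 fun n ↦ by rw [hks]; omega),
    le_antisymm (dimH_limitSet_fractions_le hB.1.le hN (fun _ ↦ one_pos) hBle hkn)
      (hΦB k hk0 fun n ↦ by rw [hks]; omega),
    le_antisymm (dimH_limitSet_fractions_le hC.1.le hM hQ hCle hkn)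
      (hΦC k hk0 fun n ↦ by rw [hks]; omega), fun c hc ↦ ?_⟩
  have hscale : ∀ n, (2 : ℝ) ^ (-(k (n + 1) : ℝ)) ≤ 1 := fun n ↦
    Real.rpow_le_one_of_one_le_of_nonpos (by norm_num) (by simp)
  have hdim1 : dimH (limitSet (fun k ↦ fractions (M k * N k) 1) k +
      c • limitSet (fun k ↦ fractions (N k) 1) k) ≤ ENNReal.ofReal ((sA + sB + sC) / 2) := by
    refine dimH_le_of_frequently_cover (D := 13) (by linarith [hA.1, hB.1, hC.1]) (by norm_num)
      fun n ↦ ⟨k (n + 1), (Nat.le_succ n).trans (hkn _), ?_⟩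
    obtain ⟨w, hw, hcw⟩ := mem_iUnion₂.1 (mem_iInter.1 hc.2 n)
    obtain ⟨F, hFc, hF⟩ := exists_finset_add_mul_mem_of_fractions (hM (k (n + 1)))
      (hN (k (n + 1))) (hscale n) hc.1 hw hcw
    refine ⟨F, hFc.trans ?_, ?_⟩
    · have h1 : (2 : ℝ) ^ (k (n + 1) * ((sA + sB + sC) / 2)) = 2 ^ (k (n + 1) * (sA - sB)) *
          2 ^ (k (n + 1) * sB) * 2 ^ (k (n + 1) * ((sC - (sA - sB)) / 2)) := by
        rw [← Real.rpow_add (by norm_num), ← Real.rpow_add (by norm_num)]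
        congr 1; ring
      rw [h1]
      gcongr <;> exact floorPow_le _ _
    · rintro _ ⟨a, ha, _, ⟨b, hb, rfl⟩, rfl⟩
      obtain ⟨u, hu, hau⟩ := mem_iUnion₂.1 (mem_iInter.1 ha.2 n)
      obtain ⟨v, hv, hbv⟩ := mem_iUnion₂.1 (mem_iInter.1 hb.2 n)
      refine iUnion₂_mono (fun y _ ↦ closedBall_subset_closedBall ?_)
        (hF a ha.1 b hb.1 u hu hau v hv hbv)
      gcongr
      norm_num
  have hdim2 : dimH (limitSet (fun k ↦ fractions (M k * N k) 1) k +
      c • limitSet (fun k ↦ fractions (N k) 1) k) ≤ ENNReal.ofReal (sA + sB) := by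
    refine dimH_le_of_frequently_cover (D := 16) (by linarith [hA.1, hB.1]) (by norm_num)
      fun n ↦ ⟨k (n + 1), (Nat.le_succ n).trans (hkn _), ?_⟩
    obtain ⟨F, hFc, hF⟩ := exists_finset_add_mul_mem (hMN (k (n + 1)))
      (hN (k (n + 1))) (hscale n) hc.1
    refine ⟨F, hFc.trans ?_, ?_⟩
    · have h1 : (2 : ℝ) ^ (k (n + 1) * (sA + sB)) = 2 ^ (k (n + 1) * (sA - sB)) *
          2 ^ (k (n + 1) * sB) * 2 ^ (k (n + 1) * sB) := by
        rw [← Real.rpow_add (by norm_num), ← Real.rpow_add (by norm_num)]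
        congr 1; ring
      rw [h1]
      push_cast
      gcongr <;> exact floorPow_le _ _
    · rintro _ ⟨a, ha, _, ⟨b, hb, rfl⟩, rfl⟩
      obtain ⟨u, hu, hau⟩ := mem_iUnion₂.1 (mem_iInter.1 ha.2 n)
      obtain ⟨v, hv, hbv⟩ := mem_iUnion₂.1 (mem_iInter.1 hb.2 n)
      refine iUnion₂_mono (fun y _ ↦ closedBall_subset_closedBall ?_)
        (hF a ha.1 b hb.1 u hu hau v hv hbv)
      gcongr
      norm_num
  have hdim3 : dimH (limitSet (fun k ↦ fractions (M k * N k) 1) k +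
      c • limitSet (fun k ↦ fractions (N k) 1) k) ≤ ENNReal.ofReal 1 := by
    rw [ENNReal.ofReal_one, ← Real.dimH_univ]
    exact dimH_mono (subset_univ _)
  rcases min_choice ((sA + sB + sC) / 2) (min (sA + sB) 1) with h | h <;> rw [h]
  · exact hdim1
  · rcases min_choice (sA + sB) 1 with h | h <;> rw [h]
    · exact hdim2
    · exact hdim3
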